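/- Corollary (output filter for $M=2$, $P_1=P_2=1$, softmax). For a square matrix $A$ let $\sigma(A)$ be the row-wise softmax, $\sigma(A)_{ij}=e^{A_{ij}}/\sum_k e^{A_{ik}}$. Let $c\in\mathbb R$ with $c\neq-1$. For a row vector $Z_1\in\mathbb R^{1\times2}$ put $B^1_c(Z_1)=c\,\mathbb 1_2+\sigma(Z_1^\top Z_1)$, and for $H\in\mathbb R^{2\times2}$ with rows $H_1,H_2$ let $$g(H)=\sigma\!\left(B^1_c(H_1)^\top H_2^\top H_2\,B^1_c(H_1)\right)$$ be the link function of the two-layer rank-one softmax attention model with sequence length $2$ and skip connection strength $c$. Let $\omega\in\mathbb R^{2\times2}$, let $V\in\mathbb R^{2\times2}$ be symmetric positive definite, let $\zeta\in\mathbb R^{2\times2}$ have i.i.d. $\mathcal N(0,1)$ entries, $H=\omega+\sqrt V\zeta$ and $Y=g(H)$. The output filter is $$g_{\rm out}(y,\omega,V)=\mathbb E\left[V^{-1}(H-\omega)\,\middle|\,Y=y\right],$$ equivalently $\mathbb E[\zeta\mid Y=y]=\sqrt V\,g_{\rm out}(y,\omega,V)$. Put $$\gamma(x,y)=\frac1{\sqrt{\log\left((x^{-1}-1)(y^{-1}-1)\right)}}\begin{bmatrix}-\log(x^{-1}-1)\\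 \log(y^{-1}-1)\end{bmatrix}.$$ 1. ($\gamma$ inverts the softmax of $zz^\top$.) If $z\in\mathbb R^2$ has $z_1\ne z_2$ and $S=\sigma(zz^\top)$, then for all $w\in\mathbb R^2$: $\sigma(ww^\top)=S$ if and only if $w=\pm\gamma(S_{12},S_{21})$. 2. $\det B^1_c(Z_1)\neq0$ for Lebesgue-almost every $Z_1\in\mathbb R^2$. 3. $Y$ is a measurable function of $\zeta$, and for almost every $y$ with respect to the law of $Y$: $y_{12},y_{21}\in(0,1)$, $(y_{12}^{-1}-1)(y_{21}^{-1}-1)>1$, and for all $l,m\in\{1,2\}$ $$[g_{\rm out}(y,\omega,V)]_{lm}=\frac{\displaystyle\sum_{Z_2}\int_{\mathbb R^2}{\rm d}Z_1\,\frac{e^{-\frac12\sum_{k,k',n=1}^2(Z_{kn}-\omega_{kn})(V^{-1})_{kk'}(Z_{k'n}-\omega_{k'n})}\sum_{l'=1}^2(Z_{l'm}-\omega_{l'm})(V^{-1})_{l'l}}{|\det B^1_c(Z_1)|}}{\displaystyle\sum_{Z_2}\int_{\mathbb R^2}{\rm d}Z_1\,\frac{e^{-\frac12\sum_{k,k',n=1}^2(Z_{kn}-\omega_{kn})(V^{-1})_{kk'}(Z_{k'n}-\omega_{k'n})}}{|\det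 B^1_c(Z_1)|}},$$ where $Z$ is the matrix with rows $Z_1,Z_2$ and the sum over $Z_2$ runs over the solutions (functions of $Z_1$) of the two equations $Z_2\,B^1_c(Z_1)=\pm\gamma(y_{12},y_{21})^\top$. All the integrals converge absolutely and the denominator is positive. -/

import Mathlib

open MeasureTheory ProbabilityTheory Matrix
open scoped MatrixOrder

noncomputable section

instance instMeasurableSpaceMatrixReal {m n : Type*} : MeasurableSpace (Matrix m n ℝ) :=
  inferInstanceAs (MeasurableSpace (m → n → ℝ))

/-- The softmax activation: the softmax function applied to every row of a square matrix. -/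
def softmax {M : ℕ} (A : Matrix (Fin M) (Fin M) ℝ) : Matrix (Fin M) (Fin M) ℝ :=
  Matrix.of fun i j => Real.exp (A i j) / ∑ k, Real.exp (A i k)

/-- The mixing function of the first `l` (non-final) layers with skip connection strength `c`,
`B⁰ = 1` and `Bˡ = Bˡ⁻¹ (c 1 + σ(Bˡ⁻¹ᵀ Z_lᵀ Z_l Bˡ⁻¹))`, as a function of the indices
`Z_1, …, Z_l`, which are `R × M` matrices (`R` is the rank of every layer). -/
def mixing {R M : ℕ} (c : ℝ) :
    (l : ℕ) → (Fin l → Matrix (Fin R) (Fin M) ℝ) → Matrix (Fin M) (Fin M) ℝ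
  | 0, _ => 1
  | l + 1, Z =>
    mixing c l (Fin.init Z) *
      (c • (1 : Matrix (Fin M) (Fin M) ℝ) +
        softmax ((mixing c l (Fin.init Z))ᵀ * (Z (Fin.last l))ᵀ * Z (Fin.last l) *
          mixing c l (Fin.init Z)))

/-- The output of the deep attention model with `l + 1` layers (`l` layers with skip connection
followed by a final softmax attention layer), as a function of the indices. -/
def deepAttention {R M : ℕ} (c : ℝ) (l : ℕ) (Z : Fin (l + 1) → Matrix (Fin R) (Fin M) ℝ) :
    Matrix (Fin M) (Fin M) ℝ :=
  softmax ((mixing c l (Fin.init Z))ᵀ * (Z (Fin.last l))ᵀ * Z (Fin.last l) *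
    mixing c l (Fin.init Z))

/-- The link function of the two-layer rank-one attention model with sequence length two:
row `l` of the argument is the index `Z_l` of layer `l`. -/
def toyLink (c : ℝ) (X : Matrix (Fin 2) (Fin 2) ℝ) : Matrix (Fin 2) (Fin 2) ℝ :=
  deepAttention c 1 fun l => Matrix.replicateRow (Fin 1) (X l)

/-- The law of a `P × M` matrix with i.i.d. standard Gaussian entries. -/
def gaussianMatrix (P M : ℕ) : Measure (Matrix (Fin P) (Fin M) ℝ) :=
  Measure.pi fun _ : Fin P => Measure.pi fun _ : Fin M => gaussianReal 0 1

instance (P M : ℕ) : IsProbabilityMeasure (gaussianMatrix P M) :=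
  inferInstanceAs (IsProbabilityMeasure
    (Measure.pi fun _ : Fin P => Measure.pi fun _ : Fin M => gaussianReal 0 1))

/-- The argument `ω + √V Z` of the link function in the output channel; for standard Gaussian `Z`
its columns are independent and column `m` has law `𝒩(ω_m, V)`. -/
def channelInput {P M : ℕ} (ω : Matrix (Fin P) (Fin M) ℝ) (V : Matrix (Fin P) (Fin P) ℝ)
    (Z : Matrix (Fin P) (Fin M) ℝ) : Matrix (Fin P) (Fin M) ℝ :=
  ω + CFC.sqrt V * Z

/-- The output channel `Y(ω, V) = g(ω + √V Z)`. -/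
def channel {P M K : ℕ} (g : Matrix (Fin P) (Fin M) ℝ → Matrix (Fin K) (Fin K) ℝ)
    (ω : Matrix (Fin P) (Fin M) ℝ) (V : Matrix (Fin P) (Fin P) ℝ)
    (Z : Matrix (Fin P) (Fin M) ℝ) : Matrix (Fin K) (Fin K) ℝ :=
  g (channelInput ω V Z)

/-- `𝔼[X | Y = y]`, the mean of the regular conditional distribution of `X` given `Y = y`. -/
def condMean {α β : Type*} [MeasurableSpace α] [MeasurableSpace β] (μ : Measure α)
    [IsFiniteMeasure μ] (X : α → ℝ) (Y : α → β) (y : β) : ℝ :=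
  ∫ t, t ∂(condDistrib X Y μ y)

/-- `𝔼[Z | Y = y]` for the output channel `Y = g(ω + √V Z)`. -/
def posteriorMean {P M K : ℕ} (g : Matrix (Fin P) (Fin M) ℝ → Matrix (Fin K) (Fin K) ℝ)
    (y : Matrix (Fin K) (Fin K) ℝ) (ω : Matrix (Fin P) (Fin M) ℝ)
    (V : Matrix (Fin P) (Fin P) ℝ) : Matrix (Fin P) (Fin M) ℝ :=
  Matrix.of fun l m =>
    condMean (gaussianMatrix P M) (fun Z => Z l m) (channel g ω V) y

/-- The output filter `g_out(y, ω, V) = 𝔼[V⁻¹ (H - ω) | g(H) = y]`, where `H = ω + √V Z`. -/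
def outputFilter {P M K : ℕ} (g : Matrix (Fin P) (Fin M) ℝ → Matrix (Fin K) (Fin K) ℝ)
    (y : Matrix (Fin K) (Fin K) ℝ) (ω : Matrix (Fin P) (Fin M) ℝ)
    (V : Matrix (Fin P) (Fin P) ℝ) : Matrix (Fin P) (Fin M) ℝ :=
  Matrix.of fun l m =>
    condMean (gaussianMatrix P M) (fun Z => (V⁻¹ * (channelInput ω V Z - ω)) l m)
      (channel g ω V) y

/-- `B_c¹(Z_1) = c 1 + σ(Z_1ᵀ Z_1)` for a first index `Z_1`, a row vector of length two. -/
def mixOne (c : ℝ) (z₁ : Fin 2 → ℝ) : Matrix (Fin 2) (Fin 2) ℝ :=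
  mixing c 1 fun _ => Matrix.replicateRow (Fin 1) z₁

/-- The logarithm under the square root in the definition of `γ`. -/
def gammaLog (x y : ℝ) : ℝ := Real.log ((x⁻¹ - 1) * (y⁻¹ - 1))

/-- The map `γ`. -/
def gammaMap (x y : ℝ) : Fin 2 → ℝ :=
  (1 / √(gammaLog x y)) • ![-Real.log (x⁻¹ - 1), Real.log (y⁻¹ - 1)]

/-- The solution `Z_2` (a row vector) of the equation `Z_2 B_c¹(Z_1) = s γ(y₁₂, y₂₁)`. -/
def secondIndex (c s : ℝ) (y : Matrix (Fin 2) (Fin 2) ℝ) (z₁ : Fin 2 → ℝ) : Fin 2 → ℝ :=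
  (s • gammaMap (y 0 1) (y 1 0)) ᵥ* (mixOne c z₁)⁻¹

theorem secondIndex_unique (c s : ℝ) (y : Matrix (Fin 2) (Fin 2) ℝ) (z₁ z₂ : Fin 2 → ℝ)
    (h : (mixOne c z₁).det ≠ 0) :
    z₂ ᵥ* mixOne c z₁ = s • gammaMap (y 0 1) (y 1 0) ↔ z₂ = secondIndex c s y z₁ := by
  have hu : IsUnit (mixOne c z₁).det := isUnit_iff_ne_zero.mpr h
  unfold secondIndex
  constructor
  · intro h2
    rw [← h2, Matrix.vecMul_vecMul, Matrix.mul_nonsing_inv _ hu, Matrix.vecMul_one]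
  · intro h2
    rw [h2, Matrix.vecMul_vecMul, Matrix.nonsing_inv_mul _ hu, Matrix.vecMul_one]

/-- The Gaussian weight `exp(-∑ (Z_lm - ω_lm) (V⁻¹)_{ll'} (Z_l'm - ω_l'm) / 2)`. -/
def gaussianWeight (ω V Z : Matrix (Fin 2) (Fin 2) ℝ) : ℝ :=
  Real.exp (-∑ l, ∑ l', ∑ m, (Z l m - ω l m) * (Z l' m - ω l' m) * V⁻¹ l l' / 2)

/-- The integrand over `Z_1` in the denominator, with `Z_2` the solution of sign `s`. -/
def denIntegrand (c : ℝ) (y ω V : Matrix (Fin 2) (Fin 2) ℝ) (s : ℝ) (z₁ : Fin 2 → ℝ) : ℝ :=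
  gaussianWeight ω V (Matrix.of ![z₁, secondIndex c s y z₁]) / |(mixOne c z₁).det|

/-- The integrand over `Z_1` in the numerator, with `Z_2` the solution of sign `s`. -/
def numIntegrand (c : ℝ) (y ω V : Matrix (Fin 2) (Fin 2) ℝ) (l m : Fin 2) (s : ℝ)
    (z₁ : Fin 2 → ℝ) : ℝ :=
  gaussianWeight ω V (Matrix.of ![z₁, secondIndex c s y z₁]) *
    (∑ l', ((Matrix.of ![z₁, secondIndex c s y z₁]) l' m - ω l' m) * V⁻¹ l' l) /
      |(mixOne c z₁).det|

/-- The sum over the two solutions `Z_2` of the integrals over `Z_1` in the denominator. -/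
def filterDen (c : ℝ) (y ω V : Matrix (Fin 2) (Fin 2) ℝ) : ℝ :=
  ∑ s ∈ ({1, -1} : Finset ℝ), ∫ z₁ : Fin 2 → ℝ, denIntegrand c y ω V s z₁

/-- The sum over the two solutions `Z_2` of the integrals over `Z_1` in the numerator. -/
def filterNum (c : ℝ) (y ω V : Matrix (Fin 2) (Fin 2) ℝ) (l m : Fin 2) : ℝ :=
  ∑ s ∈ ({1, -1} : Finset ℝ), ∫ z₁ : Fin 2 → ℝ, numIntegrand c y ω V l m s z₁

end

/-! The output depends on the indices only through the mixed index `W = Z₂ B(Z₁)`: it is `S(W)` with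
`S(w) = σ(w wᵀ)`. This map is even, and off the null diagonal `w 0 = w 1` its fibre is exactly
`{±γ}` (`softmax_vecMulVec_eq_iff`), so conditioning on `Y` amounts to fixing `W` up to sign.

The pair `(Z₁, W)` has a density with respect to Lebesgue measure: for fixed `Z₁` the map `Z₂ ↦ Z₂
B(Z₁)` is linear and, for almost every `Z₁`, invertible (`ae_det_mixOne_ne_zero`). The substitution
divides the Gaussian weight by `|det B(Z₁)|` (`map_mixedIndices_channelInput`).

No density of `Y` on its range is needed. `ae_condMean_mul_eq` takes the image of Lebesgue measure
under `S` as reference measure and shows that conditional mean times denominator and numerator have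
the same integral over every measurable set. Folding along `w ↦ -w` produces the sum over the two
signs. The law of `Y` is absolutely continuous with respect to that image
(`map_channel_absolutelyContinuous`), and positivity of the denominator
(`integral_mixedDensity_pos`) allows division. -/

/-! ### Inverting the softmax of a rank-one matrix. -/

theorem softmax_vecMulVec_zero_one (w : Fin 2 → ℝ) :
    softmax (Matrix.vecMulVec w w) 0 1 = (1 + Real.exp (w 0 * (w 0 - w 1)))⁻¹ := by
  simp only [softmax, Matrix.of_apply, Fin.sum_univ_two, Matrix.vecMulVec_apply]
  rw [mul_sub, Real.exp_sub]
  have h0 := Real.exp_pos (w 0 * w 0)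
  have h1 := Real.exp_pos (w 0 * w 1)
  field_simp
  ring

theorem softmax_vecMulVec_one_zero (w : Fin 2 → ℝ) :
    softmax (Matrix.vecMulVec w w) 1 0 = (1 + Real.exp (w 1 * (w 1 - w 0)))⁻¹ := by
  simp only [softmax, Matrix.of_apply, Fin.sum_univ_two, Matrix.vecMulVec_apply]
  rw [mul_sub, Real.exp_sub]
  have h0 := Real.exp_pos (w 1 * w 1)
  have h1 := Real.exp_pos (w 1 * w 0)
  field_simp

theorem softmax_row_sum {M : ℕ} (A : Matrix (Fin M) (Fin M) ℝ) (i : Fin M) :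
    ∑ j, softmax A i j = 1 := by
  simp only [softmax, Matrix.of_apply, ← Finset.sum_div]
  have : 0 < ∑ k, Real.exp (A i k) :=
    Finset.sum_pos (fun _ _ => Real.exp_pos _) ⟨i, Finset.mem_univ i⟩
  exact div_self this.ne'

theorem softmax_fin_two_zero_zero (A : Matrix (Fin 2) (Fin 2) ℝ) :
    softmax A 0 0 = 1 - softmax A 0 1 := by
  have h := softmax_row_sum A 0
  rw [Fin.sum_univ_two] at h
  linarith

theorem softmax_fin_two_one_one (A : Matrix (Fin 2) (Fin 2) ℝ) :
    softmax A 1 1 = 1 - softmax A 1 0 := by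
  have h := softmax_row_sum A 1
  rw [Fin.sum_univ_two] at h
  linarith

theorem softmax_vecMulVec_neg (w : Fin 2 → ℝ) :
    softmax (Matrix.vecMulVec (-w) (-w)) = softmax (Matrix.vecMulVec w w) := by
  rw [Matrix.neg_vecMulVec, Matrix.vecMulVec_neg, neg_neg]

theorem gammaLog_softmax (w : Fin 2 → ℝ) :
    gammaLog (softmax (Matrix.vecMulVec w w) 0 1) (softmax (Matrix.vecMulVec w w) 1 0) =
      (w 0 - w 1) ^ 2 := by
  rw [gammaLog, softmax_vecMulVec_zero_one, softmax_vecMulVec_one_zero, inv_inv, inv_inv,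
    add_sub_cancel_left, add_sub_cancel_left, ← Real.exp_add, Real.log_exp]
  ring

/-- The logits `log (x⁻¹ - 1)` and `log (y⁻¹ - 1)` are `w 0 * (w 0 - w 1)` and `w 1 * (w 1 - w 0)`,
so the bracket in `γ` is `-(w 0 - w 1) • w`, while the square root is `|w 0 - w 1|`. On the diagonal
both sides are zero because division by zero gives zero. -/
theorem gammaMap_softmax (w : Fin 2 → ℝ) :
    gammaMap (softmax (Matrix.vecMulVec w w) 0 1) (softmax (Matrix.vecMulVec w w) 1 0) =
      -((w 0 - w 1) / |w 0 - w 1|) • w := by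
  rw [gammaMap, gammaLog_softmax, Real.sqrt_sq_eq_abs, softmax_vecMulVec_zero_one,
    softmax_vecMulVec_one_zero, inv_inv, inv_inv, add_sub_cancel_left, add_sub_cancel_left,
    Real.log_exp, Real.log_exp]
  ext i
  fin_cases i <;> simp <;> ring

theorem gammaMap_softmax_eq_or (w : Fin 2 → ℝ) (h : w 0 ≠ w 1) :
    gammaMap (softmax (Matrix.vecMulVec w w) 0 1) (softmax (Matrix.vecMulVec w w) 1 0) = w ∨
    gammaMap (softmax (Matrix.vecMulVec w w) 0 1) (softmax (Matrix.vecMulVec w w) 1 0) = -w := by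
  rw [gammaMap_softmax]
  rcases lt_or_gt_of_ne (sub_ne_zero.mpr h) with h' | h'
  · left
    rw [abs_of_neg h', div_neg, div_self h'.ne]
    simp
  · right
    rw [abs_of_pos h', div_self h'.ne']
    simp

theorem softmax_vecMulVec_eq_iff (z w : Fin 2 → ℝ) (h : z 0 ≠ z 1) :
    softmax (Matrix.vecMulVec w w) = softmax (Matrix.vecMulVec z z) ↔
      w = gammaMap (softmax (Matrix.vecMulVec z z) 0 1) (softmax (Matrix.vecMulVec z z) 1 0) ∨
      w = -gammaMap (softmax (Matrix.vecMulVec z z) 0 1)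
        (softmax (Matrix.vecMulVec z z) 1 0) := by
  constructor
  · intro hS
    -- The softmax determines `(w 0 - w 1)²`, so `w` inherits distinct coordinates from `z`.
    have hlog := gammaLog_softmax w
    rw [hS, gammaLog_softmax z] at hlog
    have hw : w 0 ≠ w 1 := by
      intro hw
      rw [hw, sub_self] at hlog
      have := pow_eq_zero_iff (two_ne_zero) |>.mp (hlog.trans (by norm_num))
      exact h (sub_eq_zero.mp this)
    rw [← hS]
    rcases gammaMap_softmax_eq_or w hw with h' | h' <;> rw [h'] <;> simp
  · intro hw
    rcases gammaMap_softmax_eq_or z h with h' | h' <;> rw [h'] at hw <;>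
      rcases hw with rfl | rfl <;> simp

/-! ### The mixing matrix and its almost sure invertibility. -/

theorem mixOne_eq (c : ℝ) (z : Fin 2 → ℝ) :
    mixOne c z = c • (1 : Matrix (Fin 2) (Fin 2) ℝ) + softmax (Matrix.vecMulVec z z) := by
  have : (Matrix.replicateRow (Fin 1) z)ᵀ * Matrix.replicateRow (Fin 1) z =
      Matrix.vecMulVec z z := by
    ext i j
    simp [Matrix.mul_apply, Matrix.vecMulVec_apply]
  rw [← this]
  simp [mixOne, mixing]

theorem toyLink_eq (c : ℝ) (X : Matrix (Fin 2) (Fin 2) ℝ) :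
    toyLink c X =
      softmax (Matrix.vecMulVec (X 1 ᵥ* mixOne c (X 0)) (X 1 ᵥ* mixOne c (X 0))) := by
  have hm : mixing c 1 (Fin.init fun l : Fin 2 => Matrix.replicateRow (Fin 1) (X l)) =
      mixOne c (X 0) := by
    unfold mixOne
    congr 1
    ext i
    fin_cases i
    rfl
  rw [toyLink, deepAttention, hm]
  congr 1
  have hl : (Fin.last 1) = (1 : Fin 2) := rfl
  rw [hl]
  ext i j
  simp only [Matrix.mul_assoc]
  rw [← Matrix.mul_assoc, ← Matrix.transpose_mul]
  simp [Matrix.mul_apply, Matrix.vecMulVec_apply, Matrix.vecMul, dotProduct]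
  left
  ring

/-- Rows of the softmax sum to one, so the all-ones vector is an eigenvector of `B` with eigenvalue
`c + 1`; the other factor is the remaining eigenvalue. -/
theorem det_mixOne (c : ℝ) (z : Fin 2 → ℝ) :
    (mixOne c z).det = (c + 1) * (c + 1 - (1 + Real.exp (z 0 * (z 0 - z 1)))⁻¹ -
      (1 + Real.exp (z 1 * (z 1 - z 0)))⁻¹) := by
  rw [mixOne_eq, Matrix.det_fin_two]
  simp [softmax_fin_two_zero_zero, softmax_fin_two_one_one, softmax_vecMulVec_zero_one,
    softmax_vecMulVec_one_zero]
  ring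

theorem measurable_softmax_vecMulVec {ι : Type*} [MeasurableSpace ι] {f : ι → Fin 2 → ℝ}
    (hf : Measurable f) : Measurable fun x => softmax (Matrix.vecMulVec (f x) (f x)) := by
  have h : ∀ i, Measurable fun x => f x i := fun i => (measurable_pi_apply i).comp hf
  refine measurable_pi_iff.mpr fun i => measurable_pi_iff.mpr fun j => ?_
  simp only [softmax, Matrix.of_apply, Matrix.vecMulVec_apply]
  fun_prop

theorem measurable_mixOne_apply (c : ℝ) (i j : Fin 2) :
    Measurable fun z => mixOne c z i j := by
  have h := (measurable_pi_iff.mp (measurable_pi_iff.mp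
    (measurable_softmax_vecMulVec (measurable_id (α := Fin 2 → ℝ))) i) j)
  simp only [mixOne_eq, Matrix.add_apply]
  exact h.const_add _

theorem measurable_det_mixOne (c : ℝ) : Measurable fun z => (mixOne c z).det := by
  simp only [det_mixOne]
  fun_prop

theorem measurable_inv_mixOne_apply (c : ℝ) (i j : Fin 2) :
    Measurable fun z => (mixOne c z)⁻¹ i j := by
  simp only [Matrix.inv_def, Ring.inverse_eq_inv', Matrix.smul_apply, smul_eq_mul]
  refine (measurable_det_mixOne c).inv.mul ?_
  have h := measurable_mixOne_apply c
  fin_cases i <;> fin_cases j <;> simp [Matrix.adjugate_fin_two] <;> exact h _ _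

theorem measurable_gammaMap : Measurable fun y : Matrix (Fin 2) (Fin 2) ℝ =>
    gammaMap (y 0 1) (y 1 0) := by
  have h (i j : Fin 2) : Measurable fun y : Matrix (Fin 2) (Fin 2) ℝ => y i j :=
    (measurable_pi_apply j).comp (measurable_pi_apply i)
  have h0 := h 0 1
  have h1 := h 1 0
  refine measurable_pi_iff.mpr fun i => ?_
  fin_cases i <;> simp [gammaMap, gammaLog] <;> fun_prop

theorem ae_apply_zero_ne_apply_one : ∀ᵐ w : Fin 2 → ℝ, w 0 ≠ w 1 := by
  have e := (volume_preserving_finTwoArrow ℝ)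
  have hm : MeasurableSet {p : ℝ × ℝ | p.1 ≠ p.2} :=
    (measurableSet_eq_fun measurable_fst measurable_snd).compl
  refine e.quasiMeasurePreserving.ae (p := fun p : ℝ × ℝ => p.1 ≠ p.2) ?_
  refine (Measure.ae_prod_iff_ae_ae hm).mpr ?_
  filter_upwards with x
  filter_upwards [Measure.ae_ne volume x] with y hy using hy.symm

/-- The factor `c + 1` is nonzero by hypothesis. With the second coordinate `y ≠ 0` fixed, the other
factor is real analytic in the first and not identically zero, so its zeros form a null set; Fubini
concludes. -/
theorem ae_det_mixOne_ne_zero (c : ℝ) (hc : c ≠ -1) :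
    ∀ᵐ z : Fin 2 → ℝ, (mixOne c z).det ≠ 0 := by
  have hc' : c + 1 ≠ 0 := fun h => hc (by linarith)
  have e := (volume_preserving_finTwoArrow ℝ)
  let f : ℝ → ℝ → ℝ := fun y x =>
    c + 1 - (1 + Real.exp (x * (x - y)))⁻¹ - (1 + Real.exp (y * (y - x)))⁻¹
  have hfm : Measurable fun p : ℝ × ℝ => f p.2 p.1 := by fun_prop
  suffices h : ∀ᵐ p : ℝ × ℝ, f p.2 p.1 ≠ 0 by
    filter_upwards [e.quasiMeasurePreserving.ae (p := fun p : ℝ × ℝ => f p.2 p.1 ≠ 0) h] with z hz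
    rw [det_mixOne]
    exact mul_ne_zero hc' hz
  have hm : MeasurableSet {p : ℝ × ℝ | f p.2 p.1 ≠ 0} :=
    (measurableSet_eq_fun hfm measurable_const).compl
  have key : ∀ y : ℝ, y ≠ 0 → ∀ᵐ x : ℝ, f y x ≠ 0 := by
    intro y hy
    have hane : ∀ t : ℝ, 1 + Real.exp t ≠ 0 := fun t => by positivity
    have han : AnalyticOnNhd ℝ (f y) Set.univ := by
      intro x _
      have h1 : AnalyticAt ℝ (fun x => (1 + Real.exp (x * (x - y)))⁻¹) x := by
        refine AnalyticAt.inv ?_ (hane _)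
        fun_prop
      have h2 : AnalyticAt ℝ (fun x => (1 + Real.exp (y * (y - x)))⁻¹) x := by
        refine AnalyticAt.inv ?_ (hane _)
        fun_prop
      exact (analyticAt_const.sub h1).sub h2
    have hex : ∃ x, f y x ≠ 0 := by
      by_contra! hcon
      -- Comparing the values at `0` and at `y` eliminates `c`: two zeros there would force `exp (y
      -- * y) = 1`.
      have h0 := hcon 0
      have h1 := hcon y
      simp only [f, zero_mul, sub_self, mul_zero, Real.exp_zero, sub_zero] at h0 h1
      have h2 : (1 + Real.exp (y * y))⁻¹ = (1 + 1)⁻¹ := by linarith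
      have h3 := inv_injective h2
      have h4 : Real.exp (y * y) = 1 := by linarith
      rw [Real.exp_eq_one_iff] at h4
      exact hy (mul_self_eq_zero.mp h4)
    obtain ⟨x, hx⟩ := hex
    have hcod := han.preimage_zero_mem_codiscrete hx
    have := ae_restrict_le_codiscreteWithin (μ := (volume : Measure ℝ)) MeasurableSet.univ hcod
    rw [Measure.restrict_univ] at this
    filter_upwards [this] with t ht
    simpa using ht
  have hm' : MeasurableSet {q : ℝ × ℝ | f q.1 q.2 ≠ 0} := measurable_swap hm
  refine (Measure.measurePreserving_swap (μ := (volume : Measure ℝ))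
    (ν := (volume : Measure ℝ))).quasiMeasurePreserving.ae
    (p := fun q : ℝ × ℝ => f q.1 q.2 ≠ 0) ((Measure.ae_prod_iff_ae_ae hm').mpr ?_)
  filter_upwards [Measure.ae_ne volume 0] with y hy using key y hy

/-! ### The Gaussian law and its affine image. -/

theorem map_withDensity_comp {α β : Type*} [MeasurableSpace α] [MeasurableSpace β]
    (μ : Measure α) {f : α → β} (hf : Measurable f) {g : β → ENNReal} (hg : Measurable g) :
    (μ.withDensity (g ∘ f)).map f = (μ.map f).withDensity g := by
  ext s hs
  rw [Measure.map_apply hf hs, withDensity_apply _ (hf hs), withDensity_apply _ hs,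
    Measure.restrict_map hf hs, lintegral_map hg hf]
  rfl

theorem pi_fin_two_withDensity {α : Type*} [MeasurableSpace α] (ν : Measure α) [SigmaFinite ν]
    {f : α → ENNReal} (hf : Measurable f) [SigmaFinite (ν.withDensity f)] :
    Measure.pi (fun _ : Fin 2 => ν.withDensity f) =
      (Measure.pi fun _ : Fin 2 => ν).withDensity fun x => f (x 0) * f (x 1) := by
  have h1 := (measurePreserving_finTwoArrow (ν.withDensity f)).map_eq
  have h2 := (measurePreserving_finTwoArrow ν).map_eq
  rw [prod_withDensity hf hf, ← h2, ← map_withDensity_comp _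
    (MeasurableEquiv.finTwoArrow (α := α)).measurable (by fun_prop)] at h1
  have h3 := congrArg (Measure.map (MeasurableEquiv.finTwoArrow (α := α)).symm) h1
  rw [MeasurableEquiv.map_symm_map, MeasurableEquiv.map_symm_map] at h3
  exact h3

/-- The value of the constant is immaterial, since it cancels in the filter. -/
theorem gaussianMatrix_two_two_eq : ∃ K : ℝ, 0 < K ∧ gaussianMatrix 2 2 =
    (volume : Measure (Fin 2 → Fin 2 → ℝ)).withDensity fun x =>
      ENNReal.ofReal
        (K * Real.exp (-((x 0 0) ^ 2 + (x 0 1) ^ 2 + (x 1 0) ^ 2 + (x 1 1) ^ 2) / 2)) := by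
  let k : ℝ := (√(2 * Real.pi * (1 : NNReal)))⁻¹
  have hk : 0 < k := by
    simp only [k, NNReal.coe_one]
    positivity
  have h1 : (Measure.pi fun _ : Fin 2 => gaussianReal 0 1) =
      (volume : Measure (Fin 2 → ℝ)).withDensity
        fun x => gaussianPDF 0 1 (x 0) * gaussianPDF 0 1 (x 1) := by
    have hs : SigmaFinite ((volume : Measure ℝ).withDensity (gaussianPDF 0 1)) := by
      rw [← gaussianReal_of_var_ne_zero 0 one_ne_zero]
      infer_instance
    rw [gaussianReal_of_var_ne_zero 0 one_ne_zero]
    exact pi_fin_two_withDensity volume (measurable_gaussianPDF 0 1)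
  have hg := measurable_gaussianPDF 0 1
  have hs : SigmaFinite ((volume : Measure (Fin 2 → ℝ)).withDensity
      fun x => gaussianPDF 0 1 (x 0) * gaussianPDF 0 1 (x 1)) := by
    rw [← h1]
    infer_instance
  refine ⟨k ^ 4, by positivity, ?_⟩
  rw [gaussianMatrix, h1, pi_fin_two_withDensity volume (by fun_prop)]
  congr 1
  ext x
  simp only [gaussianPDF, gaussianPDFReal, NNReal.coe_one, sub_zero]
  rw [← ENNReal.ofReal_mul (by positivity), ← ENNReal.ofReal_mul (by positivity),
    ← ENNReal.ofReal_mul (by positivity)]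
  congr 1
  have : ∀ a b c d : ℝ, Real.exp (-(a ^ 2 + b ^ 2 + c ^ 2 + d ^ 2) / 2) =
      Real.exp (-a ^ 2 / (2 * 1)) * Real.exp (-b ^ 2 / (2 * 1)) *
        (Real.exp (-c ^ 2 / (2 * 1)) * Real.exp (-d ^ 2 / (2 * 1))) := by
    intro a b c d
    rw [← Real.exp_add, ← Real.exp_add, ← Real.exp_add]
    ring_nf
  rw [this]
  simp only [k, NNReal.coe_one]
  ring

theorem sqrt_mul_sqrt_of_posDef {V : Matrix (Fin 2) (Fin 2) ℝ} (hV : V.PosDef) :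
    CFC.sqrt V * CFC.sqrt V = V :=
  CFC.sqrt_mul_sqrt_self V (Matrix.nonneg_iff_posSemidef.mpr hV.posSemidef)

theorem transpose_sqrt {P : ℕ} (V : Matrix (Fin P) (Fin P) ℝ) :
    (CFC.sqrt V)ᵀ = CFC.sqrt V := by
  have h : (CFC.sqrt V).PosSemidef := Matrix.nonneg_iff_posSemidef.mp (CFC.sqrt_nonneg V)
  simpa [Matrix.conjTranspose_eq_transpose_of_trivial] using h.isHermitian.eq

theorem isUnit_det_sqrt {V : Matrix (Fin 2) (Fin 2) ℝ} (hV : V.PosDef) :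
    IsUnit (CFC.sqrt V).det := by
  have h : (CFC.sqrt V).det * (CFC.sqrt V).det = V.det := by
    rw [← Matrix.det_mul, sqrt_mul_sqrt_of_posDef hV]
  refine isUnit_iff_ne_zero.mpr fun h0 => ?_
  rw [h0, zero_mul] at h
  exact hV.det_pos.ne h

theorem inv_mul_sqrt {V : Matrix (Fin 2) (Fin 2) ℝ} (hV : V.PosDef) :
    V⁻¹ * CFC.sqrt V = (CFC.sqrt V)⁻¹ := by
  have h := sqrt_mul_sqrt_of_posDef hV
  calc V⁻¹ * CFC.sqrt V = (CFC.sqrt V * CFC.sqrt V)⁻¹ * CFC.sqrt V := by rw [h]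
    _ = (CFC.sqrt V)⁻¹ := by
      rw [Matrix.mul_inv_rev, Matrix.mul_assoc, Matrix.nonsing_inv_mul _ (isUnit_det_sqrt hV),
        Matrix.mul_one]

/-- Whitening: the exponent is half the trace of `(√V ζ)ᵀ V⁻¹ (√V ζ) = ζᵀ ζ`, up to sign. -/
theorem gaussianWeight_channelInput (ω V ζ : Matrix (Fin 2) (Fin 2) ℝ) (hV : V.PosDef) :
    gaussianWeight ω V (channelInput ω V ζ) =
      Real.exp (-((ζ 0 0) ^ 2 + (ζ 0 1) ^ 2 + (ζ 1 0) ^ 2 + (ζ 1 1) ^ 2) / 2) := by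
  have h1 : (CFC.sqrt V * ζ)ᵀ * (V⁻¹ * (CFC.sqrt V * ζ)) = ζᵀ * ζ := by
    rw [Matrix.transpose_mul, transpose_sqrt, ← Matrix.mul_assoc V⁻¹, inv_mul_sqrt hV,
      Matrix.mul_assoc, ← Matrix.mul_assoc (CFC.sqrt V),
      Matrix.mul_nonsing_inv _ (isUnit_det_sqrt hV), Matrix.one_mul]
  have h2 := congrArg Matrix.trace h1
  simp only [Matrix.trace_fin_two, Matrix.mul_apply, Matrix.transpose_apply,
    Fin.sum_univ_two] at h2
  rw [gaussianWeight]
  congr 1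
  simp only [channelInput, Matrix.add_apply, add_sub_cancel_left, Fin.sum_univ_two,
    Matrix.mul_apply]
  linarith

theorem measurable_channelInput {P M : ℕ} (ω : Matrix (Fin P) (Fin M) ℝ)
    (V : Matrix (Fin P) (Fin P) ℝ) : Measurable (channelInput ω V) := by
  have h (i : Fin P) (j : Fin M) : Measurable fun y : Matrix (Fin P) (Fin M) ℝ => y i j :=
    (measurable_pi_apply j).comp (measurable_pi_apply i)
  refine measurable_pi_iff.mpr fun i => measurable_pi_iff.mpr fun j => ?_
  simp only [channelInput, Matrix.add_apply, Matrix.mul_apply]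
  fun_prop

theorem measurable_gaussianWeight (ω V : Matrix (Fin 2) (Fin 2) ℝ) :
    Measurable (gaussianWeight ω V) := by
  have h (i : Fin 2) (j : Fin 2) : Measurable fun y : Matrix (Fin 2) (Fin 2) ℝ => y i j :=
    (measurable_pi_apply j).comp (measurable_pi_apply i)
  unfold gaussianWeight
  fun_prop

theorem map_channelInput_volume (ω V : Matrix (Fin 2) (Fin 2) ℝ) (hV : V.PosDef) :
    ∃ k : ℝ, 0 < k ∧ (volume : Measure (Fin 2 → Fin 2 → ℝ)).map (channelInput ω V) =
      ENNReal.ofReal k • (volume : Measure (Fin 2 → Fin 2 → ℝ)) := by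
  let L (A : Matrix (Fin 2) (Fin 2) ℝ) : (Fin 2 → Fin 2 → ℝ) →ₗ[ℝ] (Fin 2 → Fin 2 → ℝ) :=
    { toFun := fun ζ => A * Matrix.of ζ
      map_add' := fun x y => Matrix.mul_add A (Matrix.of x) (Matrix.of y)
      map_smul' := fun a x => Matrix.mul_smul A a (Matrix.of x) }
  have hL : LinearMap.det (L (CFC.sqrt V)) ≠ 0 := by
    intro h0
    -- A one-sided inverse suffices, as the determinant is multiplicative.
    have h1 : L (CFC.sqrt V) ∘ₗ L (CFC.sqrt V)⁻¹ = LinearMap.id := by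
      ext1 i
      apply LinearMap.ext
      intro x
      exact (Matrix.mul_nonsing_inv_cancel_left (A := CFC.sqrt V) _ (isUnit_det_sqrt hV))
    have h2 := congrArg LinearMap.det h1
    rw [LinearMap.det_comp, h0, zero_mul, LinearMap.det_id] at h2
    exact zero_ne_one h2
  refine ⟨|(LinearMap.det (L (CFC.sqrt V)))⁻¹|, abs_pos.mpr (inv_ne_zero hL), ?_⟩
  rw [← Measure.map_linearMap_addHaar_eq_smul_addHaar _ hL]
  have hLm : Measurable (L (CFC.sqrt V)) :=
    (LinearMap.continuous_of_finiteDimensional _).measurable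
  have key (a : Fin 2 → Fin 2 → ℝ) :
      (volume : Measure (Fin 2 → Fin 2 → ℝ)).map ((fun x => a + x) ∘ L (CFC.sqrt V)) =
        (volume : Measure (Fin 2 → Fin 2 → ℝ)).map (L (CFC.sqrt V)) := by
    rw [← Measure.map_map (measurable_const_add _) hLm,
      Measure.map_linearMap_addHaar_eq_smul_addHaar _ hL, Measure.map_smul,
      map_add_left_eq_self]
  exact key ω

/-! ### The joint law of the first index and the mixed second index. -/

/-- The density of the law of `(Z_1, Z_2 B_c¹(Z_1))`, up to a constant. -/
noncomputable def mixedDensity (c : ℝ) (ω V : Matrix (Fin 2) (Fin 2) ℝ)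
    (p : (Fin 2 → ℝ) × (Fin 2 → ℝ)) : ℝ :=
  gaussianWeight ω V (Matrix.of ![p.1, p.2 ᵥ* (mixOne c p.1)⁻¹]) / |(mixOne c p.1).det|

/-- The first index together with the mixed second index `Z_2 B_c¹(Z_1)`. -/
noncomputable def mixedIndices (c : ℝ) (X : Matrix (Fin 2) (Fin 2) ℝ) :
    (Fin 2 → ℝ) × (Fin 2 → ℝ) :=
  (X 0, X 1 ᵥ* mixOne c (X 0))

theorem measurable_vecMul {B : (Fin 2 → ℝ) → Matrix (Fin 2) (Fin 2) ℝ}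
    (hB : ∀ i j, Measurable fun z => B z i j) :
    Measurable fun p : (Fin 2 → ℝ) × (Fin 2 → ℝ) => p.2 ᵥ* B p.1 := by
  refine measurable_pi_iff.mpr fun i => ?_
  simp only [Matrix.vecMul, dotProduct, Fin.sum_univ_two]
  have h0 : Measurable fun p : (Fin 2 → ℝ) × (Fin 2 → ℝ) => B p.1 0 i :=
    (hB 0 i).comp measurable_fst
  have h1 : Measurable fun p : (Fin 2 → ℝ) × (Fin 2 → ℝ) => B p.1 1 i :=
    (hB 1 i).comp measurable_fst
  exact (((measurable_pi_apply 0).comp measurable_snd).mul h0).add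
    (((measurable_pi_apply 1).comp measurable_snd).mul h1)

theorem measurable_vecMul_mixOne (c : ℝ) :
    Measurable fun p : (Fin 2 → ℝ) × (Fin 2 → ℝ) => p.2 ᵥ* mixOne c p.1 :=
  measurable_vecMul (measurable_mixOne_apply c)

theorem measurable_of_vecMul_inv_mixOne (c : ℝ) :
    Measurable fun p : (Fin 2 → ℝ) × (Fin 2 → ℝ) =>
      (Matrix.of ![p.1, p.2 ᵥ* (mixOne c p.1)⁻¹] : Matrix (Fin 2) (Fin 2) ℝ) := by
  refine measurable_pi_iff.mpr fun i => ?_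
  fin_cases i
  · exact measurable_fst
  · exact measurable_vecMul (measurable_inv_mixOne_apply c)

theorem measurable_mixedDensity (c : ℝ) (ω V : Matrix (Fin 2) (Fin 2) ℝ) :
    Measurable (mixedDensity c ω V) :=
  ((measurable_gaussianWeight ω V).comp (measurable_of_vecMul_inv_mixOne c)).div
    (measurable_abs.comp ((measurable_det_mixOne c).comp measurable_fst))

theorem mixedDensity_nonneg (c : ℝ) (ω V : Matrix (Fin 2) (Fin 2) ℝ)
    (p : (Fin 2 → ℝ) × (Fin 2 → ℝ)) : 0 ≤ mixedDensity c ω V p :=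
  div_nonneg (Real.exp_pos _).le (abs_nonneg _)

theorem lintegral_vecMul (B : Matrix (Fin 2) (Fin 2) ℝ) (hB : B.det ≠ 0)
    {G : (Fin 2 → ℝ) → ENNReal} (hG : Measurable G) :
    ∫⁻ z, G (z ᵥ* B) = ENNReal.ofReal |B.det|⁻¹ * ∫⁻ w, G w := by
  have hB' : (Bᵀ).det ≠ 0 := by rwa [Matrix.det_transpose]
  have h := Real.map_matrix_volume_pi_eq_smul_volume_pi hB'
  have hm : Measurable (Matrix.toLin' Bᵀ) :=
    (LinearMap.continuous_of_finiteDimensional _).measurable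
  have h2 := lintegral_map hG hm (μ := volume)
  rw [h, lintegral_smul_measure, Matrix.det_transpose, abs_inv, smul_eq_mul] at h2
  rw [h2]
  refine lintegral_congr fun z => ?_
  rw [Matrix.toLin'_apply, Matrix.mulVec_transpose]

/-- The first coordinate is left unchanged, so by Tonelli only a linear substitution in the second
is needed, for each fixed `z` with `B(z)` invertible. Derivatives of `B` in `z` never enter. -/
theorem map_vecMul_mixOne_withDensity (c : ℝ) (hc : c ≠ -1) (ω V : Matrix (Fin 2) (Fin 2) ℝ) :
    ((volume : Measure ((Fin 2 → ℝ) × (Fin 2 → ℝ))).withDensity fun p =>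
        ENNReal.ofReal (gaussianWeight ω V (Matrix.of ![p.1, p.2]))).map
      (fun p => (p.1, p.2 ᵥ* mixOne c p.1)) =
    (volume : Measure ((Fin 2 → ℝ) × (Fin 2 → ℝ))).withDensity fun p =>
      ENNReal.ofReal (mixedDensity c ω V p) := by
  have hΦ : Measurable fun p : (Fin 2 → ℝ) × (Fin 2 → ℝ) => (p.1, p.2 ᵥ* mixOne c p.1) :=
    measurable_fst.prodMk (measurable_vecMul_mixOne c)
  have hof : Measurable fun p : (Fin 2 → ℝ) × (Fin 2 → ℝ) =>
      (Matrix.of ![p.1, p.2] : Matrix (Fin 2) (Fin 2) ℝ) := by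
    refine measurable_pi_iff.mpr fun i => ?_
    fin_cases i
    · exact measurable_fst
    · exact measurable_snd
  have hW : Measurable fun p : (Fin 2 → ℝ) × (Fin 2 → ℝ) =>
      ENNReal.ofReal (gaussianWeight ω V (Matrix.of ![p.1, p.2])) :=
    ((measurable_gaussianWeight ω V).comp hof).ennreal_ofReal
  have hρ := (measurable_mixedDensity c ω V).ennreal_ofReal
  ext A hA
  rw [Measure.map_apply hΦ hA, withDensity_apply _ (hΦ hA), withDensity_apply _ hA,
    ← lintegral_indicator (hΦ hA), ← lintegral_indicator hA, Measure.volume_eq_prod,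
    lintegral_prod _ (hW.indicator (hΦ hA)).aemeasurable,
    lintegral_prod _ (hρ.indicator hA).aemeasurable]
  refine lintegral_congr_ae ?_
  filter_upwards [ae_det_mixOne_ne_zero c hc] with z hz
  have hu : IsUnit (mixOne c z).det := isUnit_iff_ne_zero.mpr hz
  -- The test function contains `B⁻¹`, so evaluating it at `w ᵥ* B` recovers the original weight.
  have hG : Measurable fun w : Fin 2 → ℝ => A.indicator (fun p =>
      ENNReal.ofReal (gaussianWeight ω V (Matrix.of ![p.1, p.2 ᵥ* (mixOne c p.1)⁻¹]))) (z, w) :=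
    ((((measurable_gaussianWeight ω V).comp
      (measurable_of_vecMul_inv_mixOne c)).ennreal_ofReal).indicator hA).comp
      measurable_prodMk_left
  have h := lintegral_vecMul (mixOne c z) hz hG
  rw [← lintegral_const_mul _ hG] at h
  refine Eq.trans (lintegral_congr fun w => ?_) (h.trans (lintegral_congr fun w => ?_))
  · by_cases hw : (z, w ᵥ* mixOne c z) ∈ A
    · rw [Set.indicator_of_mem hw, Set.indicator_of_mem (by exact hw)]
      simp [Matrix.vecMul_vecMul, Matrix.mul_nonsing_inv _ hu]
    · rw [Set.indicator_of_notMem hw, Set.indicator_of_notMem (by exact hw)]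
  · by_cases hw : (z, w) ∈ A
    · rw [Set.indicator_of_mem hw, Set.indicator_of_mem hw, mixedDensity, div_eq_inv_mul,
        ENNReal.ofReal_mul (by positivity)]
    · rw [Set.indicator_of_notMem hw, Set.indicator_of_notMem hw, mul_zero]

theorem map_mixedIndices_channelInput (c : ℝ) (hc : c ≠ -1) (ω V : Matrix (Fin 2) (Fin 2) ℝ)
    (hV : V.PosDef) : ∃ K : ℝ, 0 < K ∧
      (gaussianMatrix 2 2).map (fun ζ => mixedIndices c (channelInput ω V ζ)) =
      (volume : Measure ((Fin 2 → ℝ) × (Fin 2 → ℝ))).withDensity fun p =>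
        ENNReal.ofReal (K * mixedDensity c ω V p) := by
  obtain ⟨K, hK, hμ⟩ := gaussianMatrix_two_two_eq
  obtain ⟨k, hk, hvol⟩ := map_channelInput_volume ω V hV
  refine ⟨K * k, mul_pos hK hk, ?_⟩
  let H : (Fin 2 → Fin 2 → ℝ) → Fin 2 → Fin 2 → ℝ := fun ζ => channelInput ω V (Matrix.of ζ)
  have hHm : Measurable H := measurable_channelInput ω V
  let Γ : Measure (Fin 2 → Fin 2 → ℝ) := gaussianMatrix 2 2
  let G : (Fin 2 → ℝ) × (Fin 2 → ℝ) → ENNReal := fun p =>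
    ENNReal.ofReal (gaussianWeight ω V (Matrix.of ![p.1, p.2]))
  let e := MeasurableEquiv.finTwoArrow (α := Fin 2 → ℝ)
  have he : Measure.map e volume = volume := (volume_preserving_finTwoArrow (Fin 2 → ℝ)).map_eq
  have hG : Measurable G := by
    have hof : Measurable fun p : (Fin 2 → ℝ) × (Fin 2 → ℝ) =>
        (Matrix.of ![p.1, p.2] : Matrix (Fin 2) (Fin 2) ℝ) := e.symm.measurable
    exact ((measurable_gaussianWeight ω V).comp hof).ennreal_ofReal
  have hGe : ∀ x, (G ∘ e ∘ H) x = ENNReal.ofReal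
      (Real.exp (-((x 0 0) ^ 2 + (x 0 1) ^ 2 + (x 1 0) ^ 2 + (x 1 1) ^ 2) / 2)) := by
    intro x
    have h1 : Matrix.of ![H x 0, H x 1] = channelInput ω V (Matrix.of x) := by
      ext i j
      fin_cases i <;> rfl
    have h2 := gaussianWeight_channelInput ω V (Matrix.of x) hV
    rw [← h1] at h2
    exact congrArg ENNReal.ofReal h2
  -- The Gaussian density is a function of `H`, so pushing the law forward along `H` only requires
  -- the image of Lebesgue measure.
  have hΓ : Γ = ENNReal.ofReal K • (volume : Measure (Fin 2 → Fin 2 → ℝ)).withDensity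
      (G ∘ e ∘ H) := by
    rw [← withDensity_smul _ (hG.comp (e.measurable.comp hHm))]
    refine hμ.trans ?_
    congr 1
    ext x
    rw [Pi.smul_apply, hGe, ENNReal.ofReal_mul hK.le, smul_eq_mul]
  have hvol' : (volume : Measure (Fin 2 → Fin 2 → ℝ)).map (e ∘ H) = ENNReal.ofReal k • volume := by
    rw [← Measure.map_map e.measurable hHm]
    refine (congrArg (Measure.map e) hvol).trans ?_
    rw [Measure.map_smul, he]
  have hΦ : Measurable fun p : (Fin 2 → ℝ) × (Fin 2 → ℝ) => (p.1, p.2 ᵥ* mixOne c p.1) :=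
    measurable_fst.prodMk (measurable_vecMul_mixOne c)
  have key : Γ.map ((fun p : (Fin 2 → ℝ) × (Fin 2 → ℝ) => (p.1, p.2 ᵥ* mixOne c p.1)) ∘ (e ∘ H)) =
      (volume : Measure ((Fin 2 → ℝ) × (Fin 2 → ℝ))).withDensity fun p =>
        ENNReal.ofReal (K * k * mixedDensity c ω V p) := by
    rw [← Measure.map_map hΦ (e.measurable.comp hHm), hΓ, Measure.map_smul,
      map_withDensity_comp _ (e.measurable.comp hHm) hG, hvol', withDensity_smul_measure,
      smul_smul, Measure.map_smul, map_vecMul_mixOne_withDensity c hc,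
      ← withDensity_smul _ (measurable_mixedDensity c ω V).ennreal_ofReal]
    congr 1
    ext p
    rw [Pi.smul_apply, ENNReal.ofReal_mul (mul_pos hK hk).le, ENNReal.ofReal_mul hK.le, smul_eq_mul]
  exact key

/-! ### Conditional means given an even function of one component. -/

theorem stronglyMeasurable_condMean {α β : Type*} [MeasurableSpace α] [MeasurableSpace β]
    (μ : Measure α) [IsFiniteMeasure μ] (X : α → ℝ) (Y : α → β) :
    StronglyMeasurable (condMean μ X Y) :=
  StronglyMeasurable.integral_condDistrib (f := fun p : β × ℝ => p.2)
    measurable_snd.stronglyMeasurable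

theorem integrable_condMean {α β : Type*} [MeasurableSpace α] [MeasurableSpace β]
    (μ : Measure α) [IsFiniteMeasure μ] {X : α → ℝ} {Y : α → β} (hX : Integrable X μ)
    (hY : Measurable Y) : Integrable (condMean μ X Y) (μ.map Y) := by
  refine Integrable.integral_condDistrib_map (f := fun p : β × ℝ => p.2) hX.aemeasurable ?_
  rw [integrable_map_measure measurable_snd.aestronglyMeasurable
    (hY.aemeasurable.prodMk hX.aemeasurable)]
  exact hX

theorem setIntegral_condMean {α β : Type*} [MeasurableSpace α] [MeasurableSpace β]
    (μ : Measure α) [IsFiniteMeasure μ] {X : α → ℝ} {Y : α → β} (hX : Integrable X μ)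
    (hY : Measurable Y) {A : Set β} (hA : MeasurableSet A) :
    ∫ a in Y ⁻¹' A, condMean μ X Y (Y a) ∂μ = ∫ a in Y ⁻¹' A, X a ∂μ := by
  have h := condExp_ae_eq_integral_condDistrib' (μ := μ) hY hX
  rw [← setIntegral_condExp hY.comap_le hX ⟨A, hA, rfl⟩]
  exact setIntegral_congr_ae (hY hA) (h.mono fun a ha _ => ha.symm)

/-- Transfer of integrals along a map whose law has density `K ρ`. -/
theorem integrable_and_setIntegral_of_map_eq_withDensity {Ω α : Type*} [MeasurableSpace Ω]
    [MeasurableSpace α] {μ : Measure Ω} {ν : Measure α} {T : Ω → α} (hT : Measurable T)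
    {ρ : α → ℝ} (hρ : Measurable ρ) (hρ0 : ∀ p, 0 ≤ ρ p) {K : ℝ} (hK : 0 < K)
    (hmap : μ.map T = ν.withDensity fun p => ENNReal.ofReal (K * ρ p))
    {g : α → ℝ} (hg : Measurable g) (hgT : Integrable (fun a => g (T a)) μ) :
    Integrable (fun p => ρ p * g p) ν ∧
      ∀ B, MeasurableSet B → ∫ a in T ⁻¹' B, g (T a) ∂μ = K * ∫ p in B, ρ p * g p ∂ν := by
  have hm : Measurable fun p => ENNReal.ofReal (K * ρ p) := (hρ.const_mul K).ennreal_ofReal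
  have hreal : ∀ p, (ENNReal.ofReal (K * ρ p)).toReal = K * ρ p := fun p =>
    ENNReal.toReal_ofReal (mul_nonneg hK.le (hρ0 p))
  constructor
  · have h1 : Integrable g (μ.map T) :=
      (integrable_map_measure hg.aestronglyMeasurable hT.aemeasurable).mpr hgT
    rw [hmap, integrable_withDensity_iff hm (Filter.Eventually.of_forall fun _ =>
      ENNReal.ofReal_lt_top)] at h1
    refine (h1.const_mul K⁻¹).congr (Filter.Eventually.of_forall fun p => ?_)
    simp only [hreal]
    field_simp
  · intro B hB
    rw [← setIntegral_map hB hg.aestronglyMeasurable hT.aemeasurable, hmap,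
      setIntegral_withDensity_eq_setIntegral_toReal_smul hm
        (Filter.Eventually.of_forall fun _ => ENNReal.ofReal_lt_top) _ hB, ← integral_const_mul]
    refine integral_congr_ae (Filter.Eventually.of_forall fun p => ?_)
    simp only [hreal, smul_eq_mul, mul_assoc]

/-- Every preimage `S ⁻¹' A` is symmetric and `η` is invariant under negation, so the two terms of
`N` have equal integrals over it. This gives the factor `2`, and Fubini turns the section integrals
into one over the product. -/
theorem integrable_map_and_setIntegral_of_even {α E β : Type*} [MeasurableSpace α]
    [MeasurableSpace β] [MeasurableSpace E] [AddCommGroup E] [MeasurableNeg E]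
    {ν : Measure α} [SFinite ν] {η : Measure E} [SFinite η] [η.IsNegInvariant]
    {S : E → β} (hS : Measurable S) (hS_neg : ∀ w, S (-w) = S w) {F : α × E → ℝ}
    (hF : Integrable F (ν.prod η)) {N : β → ℝ} (hN : StronglyMeasurable N)
    (hNS : ∀ᵐ w ∂η, N (S w) = (∫ z, F (z, w) ∂ν) + ∫ z, F (z, -w) ∂ν) :
    Integrable N (η.map S) ∧ ∀ A, MeasurableSet A →
      ∫ y in A, N y ∂(η.map S) = 2 * ∫ p in (fun p : α × E => S p.2) ⁻¹' A, F p ∂(ν.prod η) := by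
  have hn : Integrable (fun w => ∫ z, F (z, w) ∂ν) η := hF.integral_prod_right
  have hmp := Measure.measurePreserving_neg η
  have hn' : Integrable (fun w => ∫ z, F (z, -w) ∂ν) η := hmp.integrable_comp_of_integrable hn
  constructor
  · rw [integrable_map_measure hN.aestronglyMeasurable hS.aemeasurable]
    exact (hn.add hn').congr (hNS.mono fun w hw => hw.symm)
  · intro A hA
    have hSA : (Neg.neg ⁻¹' (S ⁻¹' A) : Set E) = S ⁻¹' A := by
      ext w
      simp [hS_neg]
    rw [setIntegral_map hA hN.aestronglyMeasurable hS.aemeasurable,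
      setIntegral_congr_ae (hS hA) (hNS.mono fun w hw _ => hw),
      integral_add hn.integrableOn hn'.integrableOn]
    have h1 : ∫ w in S ⁻¹' A, ∫ z, F (z, -w) ∂ν ∂η = ∫ w in S ⁻¹' A, ∫ z, F (z, w) ∂ν ∂η := by
      have h := hmp.setIntegral_preimage_emb (MeasurableEquiv.neg E).measurableEmbedding
        (fun w => ∫ z, F (z, w) ∂ν) (S ⁻¹' A)
      rwa [hSA] at h
    have h2 : (fun p : α × E => S p.2) ⁻¹' A = Set.univ ×ˢ (S ⁻¹' A) := by
      ext p
      simp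
    rw [h1, h2, ← Measure.prod_restrict, Measure.restrict_univ, integral_prod_symm _ (by
      rw [← Measure.restrict_univ (μ := ν), Measure.prod_restrict]
      exact hF.integrableOn), two_mul]

/-- Conditioning on `Y = S(W)` for an even map `S` with inverse `±γ`, where `(Z, W) = T` has density
proportional to `ρ`: the conditional mean of `x(Z, W)` is a quotient of sums over the two
preimages. -/
theorem ae_condMean_mul_eq {Ω α E β : Type*} [MeasurableSpace Ω] [MeasurableSpace α]
    [MeasurableSpace β] [MeasurableSpace E] [AddCommGroup E] [MeasurableNeg E]
    {μ : Measure Ω} [IsFiniteMeasure μ]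
    {ν : Measure α} [SFinite ν] {η : Measure E} [SFinite η] [η.IsNegInvariant]
    {T : Ω → α × E} (hT : Measurable T)
    {ρ : α × E → ℝ} (hρ : Measurable ρ) (hρ0 : ∀ p, 0 ≤ ρ p) {K : ℝ} (hK : 0 < K)
    (hmap : μ.map T = (ν.prod η).withDensity fun p => ENNReal.ofReal (K * ρ p))
    {S : E → β} (hS : Measurable S) (hS_neg : ∀ w, S (-w) = S w)
    {γ : β → E} (hγ : Measurable γ) (hγS : ∀ᵐ w ∂η, γ (S w) = w ∨ γ (S w) = -w)
    {x : α × E → ℝ} (hx : Measurable x) (hxT : Integrable (fun a => x (T a)) μ) :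
    ∀ᵐ y ∂(η.map S),
      Integrable (fun z => ρ (z, γ y) * x (z, γ y)) ν ∧
      Integrable (fun z => ρ (z, -γ y) * x (z, -γ y)) ν ∧
      condMean μ (fun a => x (T a)) (fun a => S (T a).2) y *
        ((∫ z, ρ (z, γ y) ∂ν) + ∫ z, ρ (z, -γ y) ∂ν) =
        (∫ z, ρ (z, γ y) * x (z, γ y) ∂ν) + ∫ z, ρ (z, -γ y) * x (z, -γ y) ∂ν := by
  have hY : Measurable fun a => S (T a).2 := hS.comp (measurable_snd.comp hT)
  obtain ⟨hF, hFset⟩ := integrable_and_setIntegral_of_map_eq_withDensity hT hρ hρ0 hK hmap hx hxT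
  set m := condMean μ (fun a => x (T a)) (fun a => S (T a).2)
  have hm : StronglyMeasurable m := stronglyMeasurable_condMean _ _ _
  have hmint : Integrable (fun a => m (S (T a).2)) μ := by
    have h := integrable_condMean μ hxT hY
    rwa [integrable_map_measure hm.aestronglyMeasurable hY.aemeasurable] at h
  -- The conditional mean is itself a function of `T`, so its integrals transfer to `ν.prod η` just
  -- like those of `x`.
  obtain ⟨hG, hGset⟩ := integrable_and_setIntegral_of_map_eq_withDensity hT hρ hρ0 hK hmap
    (g := fun p => m (S p.2)) (hm.measurable.comp (hS.comp measurable_snd)) hmint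
  have hmeas_int : ∀ {F : α × E → ℝ}, Measurable F →
      StronglyMeasurable fun w => ∫ z, F (z, w) ∂ν := fun hF =>
    StronglyMeasurable.integral_prod_left' (f := fun p : α × E => _) hF.stronglyMeasurable
  have hsm : ∀ {F : α × E → ℝ}, Measurable F →
      StronglyMeasurable fun y => (∫ z, F (z, γ y) ∂ν) + ∫ z, F (z, -γ y) ∂ν := fun hF =>
    ((hmeas_int hF).comp_measurable hγ).add ((hmeas_int hF).comp_measurable hγ.neg)
  -- Which of the two preimages `γ` selects is irrelevant, because both signs are summed.
  have hsum : ∀ F : α × E → ℝ, ∀ᵐ w ∂η,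
      (∫ z, F (z, γ (S w)) ∂ν) + (∫ z, F (z, -γ (S w)) ∂ν) =
        (∫ z, F (z, w) ∂ν) + ∫ z, F (z, -w) ∂ν := by
    intro F
    filter_upwards [hγS] with w hw
    rcases hw with hw | hw
    · rw [hw]
    · rw [hw, neg_neg, add_comm]
  have hρx : Measurable fun p => ρ p * x p := hρ.mul hx
  obtain ⟨hN1, hN1set⟩ := integrable_map_and_setIntegral_of_even hS hS_neg hF (hsm hρx)
    (hsum fun p => ρ p * x p)
  obtain ⟨hN2, hN2set⟩ := integrable_map_and_setIntegral_of_even hS hS_neg hG (hm.mul (hsm hρ))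
    (by
      filter_upwards [hsum ρ] with w hw
      simp only [Pi.mul_apply, hS_neg, integral_mul_const]
      rw [hw]
      ring)
  -- Both sides are integrable, so equal set integrals suffice without σ-finiteness of `η.map S`.
  -- After unfolding, the equality is the defining property of the conditional mean.
  have heq := Integrable.ae_eq_of_forall_setIntegral_eq _ _ hN2 hN1 fun A hA _ => by
    have hB : MeasurableSet ((fun p : α × E => S p.2) ⁻¹' A) := (hS.comp measurable_snd) hA
    have h := setIntegral_condMean μ hxT hY hA
    rw [hN2set A hA, hN1set A hA]
    have h1 := hGset _ hB
    have h2 := hFset _ hB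
    have h3 : K * ∫ p in (fun p : α × E => S p.2) ⁻¹' A, ρ p * m (S p.2) ∂(ν.prod η) =
        K * ∫ p in (fun p : α × E => S p.2) ⁻¹' A, ρ p * x p ∂(ν.prod η) := by
      rw [← h1, ← h2]
      exact h
    rw [mul_left_cancel₀ hK.ne' h3]
  have hsec : ∀ᵐ w ∂η, Integrable (fun z => ρ (z, w) * x (z, w)) ν := hF.prod_left_ae
  have hsec' : ∀ᵐ w ∂η, Integrable (fun z => ρ (z, -w) * x (z, -w)) ν :=
    (Measure.measurePreserving_neg η).quasiMeasurePreserving.ae hsec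
  -- Measurability of this set lets almost everywhere integrability of sections pass to the image
  -- measure.
  have hset : MeasurableSet {w : E | Integrable (fun z => ρ (z, w) * x (z, w)) ν} :=
    measurableSet_integrable (f := fun w z => ρ (z, w) * x (z, w))
      (hρx.comp measurable_swap).stronglyMeasurable
  have h1 : ∀ᵐ y ∂(η.map S), Integrable (fun z => ρ (z, γ y) * x (z, γ y)) ν := by
    refine (ae_map_iff hS.aemeasurable (hγ hset)).mpr ?_
    filter_upwards [hγS, hsec, hsec'] with w hw h h'
    rcases hw with hw | hw <;> simpa only [Set.mem_preimage, Set.mem_ofPred_eq, hw]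
  have h2 : ∀ᵐ y ∂(η.map S), Integrable (fun z => ρ (z, -γ y) * x (z, -γ y)) ν := by
    refine (ae_map_iff hS.aemeasurable (hγ.neg hset)).mpr ?_
    filter_upwards [hγS, hsec, hsec'] with w hw h h'
    rcases hw with hw | hw
    · rwa [Pi.neg_apply, hw]
    · rwa [Pi.neg_apply, hw, neg_neg]
  filter_upwards [h1, h2, heq] with y hy1 hy2 hy3
  exact ⟨hy1, hy2, hy3⟩

theorem condMean_congr {α β : Type*} [MeasurableSpace α] [MeasurableSpace β]
    (μ : Measure α) [IsFiniteMeasure μ] {X X' : α → ℝ} (h : X =ᵐ[μ] X') (Y : α → β) :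
    condMean μ X Y = condMean μ X' Y := by
  ext y
  rw [condMean, condMean, condDistrib_congr_left h]

/-! ### Application to the two-layer attention channel. -/

theorem measurable_matrix_apply {m n : Type*} (i : m) (j : n) :
    Measurable fun y : Matrix m n ℝ => y i j :=
  (measurable_pi_apply j).comp (measurable_pi_apply i)

theorem measurable_mixedIndices (c : ℝ) : Measurable (mixedIndices c) := by
  have h0 (i : Fin 2) : Measurable fun X : Matrix (Fin 2) (Fin 2) ℝ => X i :=
    measurable_pi_apply i
  exact (h0 0).prodMk ((measurable_vecMul_mixOne c).comp ((h0 0).prodMk (h0 1)))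

theorem channel_toyLink (c : ℝ) (ω V : Matrix (Fin 2) (Fin 2) ℝ) :
    channel (toyLink c) ω V = fun ζ =>
      softmax (Matrix.vecMulVec (mixedIndices c (channelInput ω V ζ)).2
        (mixedIndices c (channelInput ω V ζ)).2) := by
  ext1 ζ
  rw [channel, toyLink_eq]
  rfl

theorem measurable_channel_toyLink (c : ℝ) (ω V : Matrix (Fin 2) (Fin 2) ℝ) :
    Measurable (channel (toyLink c) ω V) := by
  rw [channel_toyLink]
  exact measurable_softmax_vecMulVec
    (measurable_snd.comp ((measurable_mixedIndices c).comp (measurable_channelInput ω V)))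

theorem integrable_gaussianMatrix_apply (P M : ℕ) (i : Fin P) (j : Fin M) :
    Integrable (fun ζ : Matrix (Fin P) (Fin M) ℝ => ζ i j) (gaussianMatrix P M) := by
  have h1 : Integrable (fun v : Fin M → ℝ => v j) (Measure.pi fun _ : Fin M => gaussianReal 0 1) :=
    integrable_comp_eval (f := id) (μ := fun _ : Fin M => gaussianReal 0 1) (i := j)
      ((memLp_id_gaussianReal 1).integrable (by norm_num))
  exact integrable_comp_eval (X := fun _ : Fin P => Fin M → ℝ)
    (μ := fun _ : Fin P => Measure.pi fun _ : Fin M => gaussianReal 0 1) (i := i) h1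

/-- The entries of `V⁻¹ (Z - ω)` in terms of `Z_1` and `Z_2 B_c¹(Z_1)`. -/
noncomputable def mixedScore (c : ℝ) (ω V : Matrix (Fin 2) (Fin 2) ℝ) (l m : Fin 2)
    (p : (Fin 2 → ℝ) × (Fin 2 → ℝ)) : ℝ :=
  ∑ l', ((Matrix.of ![p.1, p.2 ᵥ* (mixOne c p.1)⁻¹] : Matrix (Fin 2) (Fin 2) ℝ) l' m - ω l' m) *
    V⁻¹ l' l

theorem measurable_mixedScore (c : ℝ) (ω V : Matrix (Fin 2) (Fin 2) ℝ) (l m : Fin 2) :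
    Measurable (mixedScore c ω V l m) :=
  Finset.measurable_fun_sum _ fun l' _ =>
    (((measurable_matrix_apply l' m).comp (measurable_of_vecMul_inv_mixOne c)).sub_const
      _).mul_const _

theorem denIntegrand_eq (c : ℝ) (y ω V : Matrix (Fin 2) (Fin 2) ℝ) (s : ℝ) :
    denIntegrand c y ω V s = fun z =>
      mixedDensity c ω V (z, s • gammaMap (y 0 1) (y 1 0)) := rfl

theorem numIntegrand_eq (c : ℝ) (y ω V : Matrix (Fin 2) (Fin 2) ℝ) (l m : Fin 2) (s : ℝ) :
    numIntegrand c y ω V l m s = fun z =>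
      mixedDensity c ω V (z, s • gammaMap (y 0 1) (y 1 0)) *
        mixedScore c ω V l m (z, s • gammaMap (y 0 1) (y 1 0)) := by
  ext z
  rw [mixedDensity, div_mul_eq_mul_div]
  rfl

theorem one_ne_neg_one_real : (1 : ℝ) ≠ -1 := by norm_num

theorem filterDen_eq (c : ℝ) (y ω V : Matrix (Fin 2) (Fin 2) ℝ) :
    filterDen c y ω V = (∫ z, mixedDensity c ω V (z, gammaMap (y 0 1) (y 1 0))) +
      ∫ z, mixedDensity c ω V (z, -gammaMap (y 0 1) (y 1 0)) := by
  rw [filterDen, Finset.sum_pair one_ne_neg_one_real]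
  simp only [denIntegrand_eq, one_smul, neg_smul]

theorem filterNum_eq (c : ℝ) (y ω V : Matrix (Fin 2) (Fin 2) ℝ) (l m : Fin 2) :
    filterNum c y ω V l m =
      (∫ z, mixedDensity c ω V (z, gammaMap (y 0 1) (y 1 0)) *
        mixedScore c ω V l m (z, gammaMap (y 0 1) (y 1 0))) +
      ∫ z, mixedDensity c ω V (z, -gammaMap (y 0 1) (y 1 0)) *
        mixedScore c ω V l m (z, -gammaMap (y 0 1) (y 1 0)) := by
  rw [filterNum, Finset.sum_pair one_ne_neg_one_real]
  simp only [numIntegrand_eq, one_smul, neg_smul]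

/-- The nonnegative integrand vanishes only where `det B = 0`, a null set. Integrability is
essential, as a divergent integral would be zero by convention. -/
theorem integral_mixedDensity_pos (c : ℝ) (hc : c ≠ -1) (ω V : Matrix (Fin 2) (Fin 2) ℝ)
    (w : Fin 2 → ℝ) (h : Integrable fun z => mixedDensity c ω V (z, w)) :
    0 < ∫ z, mixedDensity c ω V (z, w) := by
  rw [integral_pos_iff_support_of_nonneg (fun z => mixedDensity_nonneg c ω V _) h]
  have hae : ∀ᵐ z : Fin 2 → ℝ, z ∈ Function.support fun z => mixedDensity c ω V (z, w) := by
    filter_upwards [ae_det_mixOne_ne_zero c hc] with z hz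
    exact div_ne_zero (Real.exp_ne_zero _) (abs_ne_zero.mpr hz)
  refine pos_iff_ne_zero.mpr fun h0 => ?_
  obtain ⟨z, hz, hz'⟩ := (hae.and (measure_eq_zero_iff_ae_notMem.mp h0)).exists
  exact hz' hz

theorem map_mixedIndices_absolutelyContinuous (c : ℝ) (hc : c ≠ -1)
    (ω V : Matrix (Fin 2) (Fin 2) ℝ) (hV : V.PosDef) :
    (gaussianMatrix 2 2).map (fun ζ => mixedIndices c (channelInput ω V ζ)) ≪
      (volume : Measure ((Fin 2 → ℝ) × (Fin 2 → ℝ))) := by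
  obtain ⟨K, _, hmap⟩ := map_mixedIndices_channelInput c hc ω V hV
  rw [hmap]
  exact withDensity_absolutelyContinuous _ _

/-- The channel is `S` applied to the second component of a pair with a Lebesgue density. Hence
properties of almost every output can be checked at `S w` for almost every `w`. -/
theorem map_channel_absolutelyContinuous (c : ℝ) (hc : c ≠ -1)
    (ω V : Matrix (Fin 2) (Fin 2) ℝ) (hV : V.PosDef) :
    (gaussianMatrix 2 2).map (channel (toyLink c) ω V) ≪
      (volume : Measure (Fin 2 → ℝ)).map fun w => softmax (Matrix.vecMulVec w w) := by
  have hT : Measurable fun ζ => mixedIndices c (channelInput ω V ζ) :=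
    (measurable_mixedIndices c).comp (measurable_channelInput ω V)
  have hS : Measurable fun w : Fin 2 → ℝ => softmax (Matrix.vecMulVec w w) :=
    measurable_softmax_vecMulVec measurable_id
  have h : channel (toyLink c) ω V = (fun w : Fin 2 → ℝ => softmax (Matrix.vecMulVec w w)) ∘
      Prod.snd ∘ fun ζ => mixedIndices c (channelInput ω V ζ) := channel_toyLink c ω V
  rw [h, ← Measure.map_map hS (measurable_snd.comp hT), ← Measure.map_map measurable_snd hT]
  refine Measure.AbsolutelyContinuous.map ?_ hS
  exact ((map_mixedIndices_absolutelyContinuous c hc ω V hV).map measurable_snd).trans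
    Measure.quasiMeasurePreserving_snd.absolutelyContinuous

theorem ae_det_mixOne_channelInput_ne_zero (c : ℝ) (hc : c ≠ -1)
    (ω V : Matrix (Fin 2) (Fin 2) ℝ) (hV : V.PosDef) :
    ∀ᵐ ζ ∂(gaussianMatrix 2 2), (mixOne c (channelInput ω V ζ 0)).det ≠ 0 := by
  have hT : Measurable fun ζ => mixedIndices c (channelInput ω V ζ) :=
    (measurable_mixedIndices c).comp (measurable_channelInput ω V)
  have h1 : ∀ᵐ p : (Fin 2 → ℝ) × (Fin 2 → ℝ), (mixOne c p.1).det ≠ 0 :=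
    Measure.quasiMeasurePreserving_fst.ae (ae_det_mixOne_ne_zero c hc)
  exact ae_of_ae_map hT.aemeasurable
    ((map_mixedIndices_absolutelyContinuous c hc ω V hV).ae_le h1)

/-- Where `B` is invertible the mixing can be undone; symmetry of `V⁻¹` reconciles the index order
`V⁻¹ l' l` with the matrix product. -/
theorem mixedScore_mixedIndices (c : ℝ) (ω V X : Matrix (Fin 2) (Fin 2) ℝ) (hV : V.PosDef)
    (hX : (mixOne c (X 0)).det ≠ 0) (l m : Fin 2) :
    mixedScore c ω V l m (mixedIndices c X) = (V⁻¹ * (X - ω)) l m := by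
  have hu : IsUnit (mixOne c (X 0)).det := isUnit_iff_ne_zero.mpr hX
  have h1 : (Matrix.of ![X 0, X 1 ᵥ* mixOne c (X 0) ᵥ* (mixOne c (X 0))⁻¹] :
      Matrix (Fin 2) (Fin 2) ℝ) = X := by
    rw [Matrix.vecMul_vecMul, Matrix.mul_nonsing_inv _ hu, Matrix.vecMul_one]
    ext i j
    fin_cases i <;> rfl
  have hsymm : ∀ i j, V⁻¹ i j = V⁻¹ j i := fun i j => by
    have h := hV.inv.isHermitian.apply i j
    simpa using h.symm
  rw [mixedScore, mixedIndices, h1, Matrix.mul_apply]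
  refine Finset.sum_congr rfl fun l' _ => ?_
  rw [Matrix.sub_apply, mul_comm, hsymm]

theorem inv_mul_channelInput_sub (ω V ζ : Matrix (Fin 2) (Fin 2) ℝ) (hV : V.PosDef) :
    V⁻¹ * (channelInput ω V ζ - ω) = (CFC.sqrt V)⁻¹ * ζ := by
  rw [channelInput, add_sub_cancel_left, ← Matrix.mul_assoc, inv_mul_sqrt hV]

theorem integrable_inv_mul_channelInput_sub (ω V : Matrix (Fin 2) (Fin 2) ℝ) (hV : V.PosDef)
    (l m : Fin 2) : Integrable (fun ζ => (V⁻¹ * (channelInput ω V ζ - ω)) l m)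
      (gaussianMatrix 2 2) := by
  simp only [inv_mul_channelInput_sub ω V _ hV]
  simp only [Matrix.mul_apply]
  exact integrable_finsetSum _ fun k _ => (integrable_gaussianMatrix_apply 2 2 k m).const_mul _

/-- The conditional mean given the output of a function of `Z_1` and `Z_2 B_c¹(Z_1)`. -/
theorem ae_condMean_channel (c : ℝ) (hc : c ≠ -1) (ω V : Matrix (Fin 2) (Fin 2) ℝ)
    (hV : V.PosDef) {x : (Fin 2 → ℝ) × (Fin 2 → ℝ) → ℝ} (hx : Measurable x)
    {X : Matrix (Fin 2) (Fin 2) ℝ → ℝ} (hX : Integrable X (gaussianMatrix 2 2))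
    (hXx : X =ᵐ[gaussianMatrix 2 2] fun ζ => x (mixedIndices c (channelInput ω V ζ))) :
    ∀ᵐ y ∂((gaussianMatrix 2 2).map (channel (toyLink c) ω V)),
      Integrable (fun z => mixedDensity c ω V (z, gammaMap (y 0 1) (y 1 0)) *
        x (z, gammaMap (y 0 1) (y 1 0))) ∧
      Integrable (fun z => mixedDensity c ω V (z, -gammaMap (y 0 1) (y 1 0)) *
        x (z, -gammaMap (y 0 1) (y 1 0))) ∧
      condMean (gaussianMatrix 2 2) X (channel (toyLink c) ω V) y * filterDen c y ω V =
        (∫ z, mixedDensity c ω V (z, gammaMap (y 0 1) (y 1 0)) *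
          x (z, gammaMap (y 0 1) (y 1 0))) +
        ∫ z, mixedDensity c ω V (z, -gammaMap (y 0 1) (y 1 0)) *
          x (z, -gammaMap (y 0 1) (y 1 0)) := by
  obtain ⟨K, hK, hmap⟩ := map_mixedIndices_channelInput c hc ω V hV
  refine (map_channel_absolutelyContinuous c hc ω V hV).ae_le ?_
  have hγ : ∀ᵐ w : Fin 2 → ℝ, gammaMap (softmax (Matrix.vecMulVec w w) 0 1)
        (softmax (Matrix.vecMulVec w w) 1 0) = w ∨
      gammaMap (softmax (Matrix.vecMulVec w w) 0 1) (softmax (Matrix.vecMulVec w w) 1 0) = -w := by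
    filter_upwards [ae_apply_zero_ne_apply_one] with w hw using gammaMap_softmax_eq_or w hw
  have h := ae_condMean_mul_eq (μ := gaussianMatrix 2 2)
    ((measurable_mixedIndices c).comp (measurable_channelInput ω V))
    (measurable_mixedDensity c ω V) (mixedDensity_nonneg c ω V) hK hmap
    (measurable_softmax_vecMulVec (measurable_id (α := Fin 2 → ℝ))) softmax_vecMulVec_neg
    measurable_gammaMap hγ hx (hX.congr hXx)
  filter_upwards [h] with y hy
  rw [filterDen_eq, condMean_congr _ hXx, channel_toyLink]
  exact hy

theorem ae_channel_mem (c : ℝ) (hc : c ≠ -1) (ω V : Matrix (Fin 2) (Fin 2) ℝ) (hV : V.PosDef) :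
    ∀ᵐ y ∂((gaussianMatrix 2 2).map (channel (toyLink c) ω V)),
      y 0 1 ∈ Set.Ioo 0 1 ∧ y 1 0 ∈ Set.Ioo 0 1 ∧ 0 < gammaLog (y 0 1) (y 1 0) := by
  refine (map_channel_absolutelyContinuous c hc ω V hV).ae_le ?_
  have hS : Measurable fun w : Fin 2 → ℝ => softmax (Matrix.vecMulVec w w) :=
    measurable_softmax_vecMulVec measurable_id
  have h01 := measurable_matrix_apply (m := Fin 2) (n := Fin 2) 0 1
  have h10 := measurable_matrix_apply (m := Fin 2) (n := Fin 2) 1 0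
  have hlog : Measurable fun y : Matrix (Fin 2) (Fin 2) ℝ => gammaLog (y 0 1) (y 1 0) :=
    Real.measurable_log.comp ((h01.inv.sub_const 1).mul (h10.inv.sub_const 1))
  have hset : MeasurableSet {y : Matrix (Fin 2) (Fin 2) ℝ |
      y 0 1 ∈ Set.Ioo 0 1 ∧ y 1 0 ∈ Set.Ioo 0 1 ∧ 0 < gammaLog (y 0 1) (y 1 0)} :=
    (h01 measurableSet_Ioo).inter ((h10 measurableSet_Ioo).inter (hlog measurableSet_Ioi))
  refine (ae_map_iff hS.aemeasurable hset).mpr ?_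
  have hIoo : ∀ t : ℝ, (1 + Real.exp t)⁻¹ ∈ Set.Ioo (0 : ℝ) 1 := fun t =>
    ⟨by positivity, inv_lt_one_of_one_lt₀ (by linarith [Real.exp_pos t])⟩
  filter_upwards [ae_apply_zero_ne_apply_one] with w hw
  refine ⟨?_, ?_, ?_⟩
  · rw [softmax_vecMulVec_zero_one]
    exact hIoo _
  · rw [softmax_vecMulVec_one_zero]
    exact hIoo _
  · rw [gammaLog_softmax]
    have := sub_ne_zero.mpr hw
    positivity

theorem mainTheorem5 (c : ℝ) (hc : c ≠ -1) (ω V : Matrix (Fin 2) (Fin 2) ℝ) (hV : V.PosDef) :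
    (∀ z w : Fin 2 → ℝ, z 0 ≠ z 1 →
      (softmax (Matrix.vecMulVec w w) = softmax (Matrix.vecMulVec z z) ↔
        w = gammaMap (softmax (Matrix.vecMulVec z z) 0 1) (softmax (Matrix.vecMulVec z z) 1 0) ∨
        w = -gammaMap (softmax (Matrix.vecMulVec z z) 0 1)
          (softmax (Matrix.vecMulVec z z) 1 0))) ∧
    (∀ᵐ z₁ : Fin 2 → ℝ, (mixOne c z₁).det ≠ 0) ∧
    Measurable (channel (toyLink c) ω V) ∧
    ∀ᵐ y ∂((gaussianMatrix 2 2).map (channel (toyLink c) ω V)),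
      y 0 1 ∈ Set.Ioo 0 1 ∧ y 1 0 ∈ Set.Ioo 0 1 ∧ 0 < gammaLog (y 0 1) (y 1 0) ∧
      (∀ s ∈ ({1, -1} : Finset ℝ), Integrable (denIntegrand c y ω V s)) ∧
      (∀ s ∈ ({1, -1} : Finset ℝ), ∀ l m, Integrable (numIntegrand c y ω V l m s)) ∧
      0 < filterDen c y ω V ∧
      (∀ l m, outputFilter (toyLink c) y ω V l m = filterNum c y ω V l m / filterDen c y ω V) ∧
      posteriorMean (toyLink c) y ω V =
        CFC.sqrt V * Matrix.of fun l m => filterNum c y ω V l m / filterDen c y ω V := by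
  refine ⟨fun z w hz => softmax_vecMulVec_eq_iff z w hz, ae_det_mixOne_ne_zero c hc,
    measurable_channel_toyLink c ω V, ?_⟩
  have hdet := ae_det_mixOne_channelInput_ne_zero c hc ω V hV
  -- The constant observable is used only for its integrability part, which is convergence of the
  -- denominator integrals.
  have hone := ae_condMean_channel c hc ω V hV (x := fun _ => 1) measurable_const
    (X := fun _ => 1) (integrable_const _) (Filter.EventuallyEq.refl _ _)
  have hscore := fun l m => ae_condMean_channel c hc ω V hV (measurable_mixedScore c ω V l m)
    (integrable_inv_mul_channelInput_sub ω V hV l m)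
    (hdet.mono fun ζ hζ => (mixedScore_mixedIndices c ω V _ hV hζ l m).symm)
  -- Since `ζ = √V V⁻¹ (H - ω)`, an entry of `ζ` is almost surely a linear combination of scores.
  -- Linearity is then needed only for the explicit integrals, not for conditional distributions.
  have hpost := fun l m => ae_condMean_channel c hc ω V hV
    (x := fun p => ∑ k, CFC.sqrt V l k * mixedScore c ω V k m p)
    (Finset.measurable_fun_sum _ fun k _ => (measurable_mixedScore c ω V k m).const_mul _)
    (integrable_gaussianMatrix_apply 2 2 l m) (hdet.mono fun ζ hζ => by
      simp only [mixedScore_mixedIndices c ω V _ hV hζ]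
      rw [← Matrix.mul_apply, inv_mul_channelInput_sub ω V ζ hV, ← Matrix.mul_assoc,
        Matrix.mul_nonsing_inv _ (isUnit_det_sqrt hV), Matrix.one_mul])
  filter_upwards [ae_channel_mem c hc ω V hV, hone,
    ae_all_iff.mpr fun l => ae_all_iff.mpr (hscore l),
    ae_all_iff.mpr fun l => ae_all_iff.mpr (hpost l)] with y hy hy1 hys hyp
  simp only [mul_one] at hy1
  have hpos : 0 < filterDen c y ω V := by
    rw [filterDen_eq]
    exact add_pos (integral_mixedDensity_pos c hc ω V _ hy1.1)
      (integral_mixedDensity_pos c hc ω V _ hy1.2.1)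
  refine ⟨hy.1, hy.2.1, hy.2.2, ?_, ?_, hpos, ?_, ?_⟩
  · intro s hs
    rw [denIntegrand_eq]
    rcases Finset.mem_insert.mp hs with rfl | hs
    · simpa only [one_smul] using hy1.1
    · rw [Finset.mem_singleton.mp hs]
      simpa only [neg_smul, one_smul] using hy1.2.1
  · intro s hs l m
    rw [numIntegrand_eq]
    rcases Finset.mem_insert.mp hs with rfl | hs
    · simpa only [one_smul] using (hys l m).1
    · rw [Finset.mem_singleton.mp hs]
      simpa only [neg_smul, one_smul] using (hys l m).2.1
  · intro l m
    rw [eq_div_iff hpos.ne', filterNum_eq]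
    exact (hys l m).2.2
  · ext l m
    have h := (hyp l m).2.2
    simp only [Finset.mul_sum, mul_left_comm _ (CFC.sqrt V l _)] at h
    -- Splitting the sum uses the integrability of each score term already obtained in `hys`.
    rw [integral_finsetSum _ fun k _ => (hys k m).1.const_mul _,
      integral_finsetSum _ fun k _ => (hys k m).2.1.const_mul _, ← Finset.sum_add_distrib] at h
    simp only [integral_const_mul, ← mul_add, ← filterNum_eq] at h
    rw [Matrix.mul_apply]
    simp only [Matrix.of_apply, ← mul_div_assoc, ← Finset.sum_div]
    rw [eq_div_iff hpos.ne']
    exact h
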